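/- A topological dynamical system is a pair $(Y,S)$ where $Y$ is a compact metric space and $S:Y\to Y$ is a homeomorphism that has a fixed point and finitely many points of period $n$ for each $n\ge 1$. For a map $T:X\to X$ put $\mathsf F_T(n)=|\{x\in X: T^n(x)=x\}|$, and, when these numbers are finite for all $n\ge1$, let $$\zeta_T(z)=\exp\Big(\sum_{n\ge 1}\mathsf F_T(n)\frac{z^n}{n}\Big)\in\mathbb C[[z]]$$ be the dynamical zeta function; it is called rational if it is the power series expansion of a quotient of two polynomials, and irrational otherwise. Given $(Y,S)$ with metric $d$, let $X=Y\times\{0,1\}$ be the doubled space, with the metric $d_X((y,e),(y',e'))=d(y,y')+1$ if $e\ne e'$ and $d_X((y,e),(y',e'))=d(y,y')$ if $e=e'$. Let $T:X\to X$ be the homeomorphism $T(y,e)=(S(y),e+1 \bmod 2)$, and let $\imath(y,e)=(y,e+1\bmod 2)$, a continuous involution of $X$ commuting with $T$. Let $\overline X$ be the quotient of $X$ by the equivalence relation with classes $\{x,\imath(x)\}$, and let $\overline T$ be the map induced by $T$ on $\overline X$. Then there is a topological dynamical system $(Y,S)$ with $$\mathsf F_S(n)=\begin{cases}2^n+1 &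 \text{if } n \text{ is even},\\ \sum_{d\mid n} d\,2^{(d-1)/2} & \text{if } n\text{ is odd}\end{cases}\qquad(n\ge1).$$ For the doubled system $(X,T)$ of this $(Y,S)$, the map $T$ has finitely many points of each period $n\ge1$, and $$\zeta_T(z)=\frac{1}{(1-z^2)(1-4z^2)},$$ so $\zeta_T$ is rational. The map $[(y,e)]\mapsto y$ is a homeomorphism $\overline X\to Y$ that carries $\overline T$ to $S$, so that $\zeta_{\overline T}=\zeta_S$, and $\zeta_S$ is irrational. -/

import Mathlib

namespace Halving

/-! ### Topological dynamical systems, periodic points, zeta functions -/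

/-- A homeomorphism of a compact metric space is a topological dynamical system if it has a
fixed point and finitely many points of period `n` for each `n ≥ 1`. -/
structure IsTopologicalDynamicalSystem {Y : Type*} [MetricSpace Y] [CompactSpace Y]
    (S : Y ≃ₜ Y) : Prop where
  exists_fixed : ∃ y, S y = y
  finite_periodic : ∀ n : ℕ, 1 ≤ n → (Function.ptsOfPeriod S n).Finite

/-- The number of points `x` with `T^n x = x`. -/
noncomputable def numPeriodic {X : Type*} (T : X → X) (n : ℕ) : ℕ :=
  (Function.ptsOfPeriod T n).ncard

/-- The power series `∑_{n ≥ 1} F_T(n) z^n / n`. -/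
noncomputable def logZeta {X : Type*} (T : X → X) : PowerSeries ℂ :=
  PowerSeries.mk fun n => if n = 0 then 0 else (numPeriodic T n : ℂ) / (n : ℂ)

/-- The constant term of `logZeta T` is zero, so it may be substituted into `exp`. -/
theorem hasSubst_logZeta {X : Type*} (T : X → X) : PowerSeries.HasSubst (logZeta T) :=
  PowerSeries.HasSubst.of_constantCoeff_zero' (by simp [logZeta])

/-- The dynamical zeta function `exp (∑_{n ≥ 1} F_T(n) z^n / n)`. -/
noncomputable def zeta {X : Type*} (T : X → X) : PowerSeries ℂ :=
  (PowerSeries.exp ℂ).subst (logZeta T)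

/-- A power series is rational if it is the expansion of a quotient `P / Q` of polynomials. -/
def IsRational (f : PowerSeries ℂ) : Prop :=
  ∃ P Q : Polynomial ℂ, Q ≠ 0 ∧ (Q : PowerSeries ℂ) * f = (P : PowerSeries ℂ)

/-! ### The doubled system -/

/-- The doubled space `Y × {0, 1}`. -/
@[ext]
structure Doubled (Y : Type*) where
  point : Y
  parity : ZMod 2

namespace Doubled

/-- The metric `d(y, y') + [e ≠ e']` on the doubled space. -/
noncomputable instance {Y : Type*} [MetricSpace Y] : MetricSpace (Doubled Y) where
  dist x y := dist x.point y.point + if x.parity = y.parity then 0 else 1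
  dist_self x := by simp
  dist_comm x y := by simp only [dist_comm x.point, eq_comm (a := x.parity)]
  dist_triangle x y z := by
    have h := dist_triangle x.point y.point z.point
    split_ifs with h1 h2 h3 h3 h2 h3 h3 <;> first | linarith | simp_all
  eq_of_dist_eq_zero {x y} h := by
    have h0 : 0 ≤ dist x.point y.point := dist_nonneg
    change dist x.point y.point + (if x.parity = y.parity then 0 else 1) = 0 at h
    split_ifs at h with h1
    · exact Doubled.ext (dist_eq_zero.1 (by linarith)) h1
    · linarith

theorem dist_def {Y : Type*} [MetricSpace Y] (x y : Doubled Y) :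
    dist x y = dist x.point y.point + if x.parity = y.parity then 0 else 1 := rfl

theorem continuous_map {Y : Type*} [MetricSpace Y] {g : Y → Y} (hg : Continuous g)
    (σ : ZMod 2 → ZMod 2) :
    Continuous fun x : Doubled Y => (⟨g x.point, σ x.parity⟩ : Doubled Y) := by
  rw [Metric.continuous_iff]
  intro b ε hε
  obtain ⟨δ, hδ, h⟩ := Metric.continuous_iff.1 hg b.point ε hε
  refine ⟨min δ 1, lt_min hδ one_pos, fun a ha => ?_⟩
  have h0 : 0 ≤ dist a.point b.point := dist_nonneg
  rw [dist_def] at ha ⊢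
  have h1 := lt_of_lt_of_le ha (min_le_left _ _)
  have h2 := lt_of_lt_of_le ha (min_le_right _ _)
  by_cases hp : a.parity = b.parity
  · simp only [hp, if_true, add_zero] at h1 ⊢
    exact h _ h1
  · simp only [hp, if_false] at h2
    linarith

theorem isometry_mk {Y : Type*} [MetricSpace Y] (e : ZMod 2) :
    Isometry fun y : Y => (⟨y, e⟩ : Doubled Y) :=
  Isometry.of_dist_eq fun x y => by simp [dist_def]

instance {Y : Type*} [MetricSpace Y] [CompactSpace Y] : CompactSpace (Doubled Y) := by
  have h : (Set.univ : Set (Doubled Y)) =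
      ⋃ e : ZMod 2, Set.range fun y : Y => (⟨y, e⟩ : Doubled Y) := by
    ext x
    simp only [Set.mem_univ, Set.mem_iUnion, true_iff]
    exact ⟨x.parity, x.point, rfl⟩
  exact ⟨h ▸ isCompact_iUnion fun e => isCompact_range (isometry_mk e).continuous⟩

/-- The doubled map `T (y, e) = (S y, e + 1 mod 2)`. -/
def map {Y : Type*} [MetricSpace Y] (S : Y ≃ₜ Y) : Doubled Y ≃ₜ Doubled Y where
  toFun x := ⟨S x.point, x.parity + 1⟩
  invFun x := ⟨S.symm x.point, x.parity - 1⟩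
  left_inv x := by simp
  right_inv x := by simp
  continuous_toFun := continuous_map S.continuous (· + 1)
  continuous_invFun := continuous_map S.symm.continuous (· - 1)

/-- The involution `(y, e) ↦ (y, e + 1 mod 2)`. -/
def flip {Y : Type*} (x : Doubled Y) : Doubled Y := ⟨x.point, x.parity + 1⟩

theorem flip_involutive {Y : Type*} : Function.Involutive (flip (Y := Y)) := fun x => by
  have h : ∀ e : ZMod 2, e + 1 + 1 = e := by decide
  simp [flip, h]

theorem continuous_flip {Y : Type*} [MetricSpace Y] : Continuous (flip (Y := Y)) :=
  continuous_map continuous_id (· + 1)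

theorem map_commute_flip {Y : Type*} [MetricSpace Y] (S : Y ≃ₜ Y) :
    Function.Commute (map S) (flip (Y := Y)) := fun _ => rfl

end Doubled

/-! ### The halved system of a map commuting with an involution -/

/-- The equivalence relation whose classes are the sets `{x, i x}`. -/
def involutionSetoid {X : Type*} (i : X → X) (hi : Function.Involutive i) : Setoid X where
  r x y := x = y ∨ x = i y
  iseqv :=
    { refl := fun _ => Or.inl rfl
      symm := by
        rintro x y (h | h)
        · exact Or.inl h.symm
        · exact Or.inr (by rw [h, hi])
      trans := by
        rintro x y z (rfl | rfl) (rfl | rfl)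
        · exact Or.inl rfl
        · exact Or.inr rfl
        · exact Or.inr rfl
        · exact Or.inl (hi _) }

/-- The halved space; it carries the quotient topology. -/
abbrev Halved {X : Type*} (i : X → X) (hi : Function.Involutive i) : Type _ :=
  Quotient (involutionSetoid i hi)

/-- The halved map, sending the class of `x` to the class of `T x`. -/
def halvedMap {X : Type*} (T i : X → X) (hi : Function.Involutive i)
    (hT : Function.Commute T i) : Halved i hi → Halved i hi :=
  Quotient.map T (by
    rintro x y (rfl | rfl)
    · exact Or.inl rfl
    · exact Or.inr (hT y))

end Halving

/-!
The system is made of finite orbits: a fixed point, and countably many further finite orbits, all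
isolated, which accumulate only at the fixed point. Any numbers `o d` of orbits of length `d` with
`o 1 = 1` are realized in this way on the one-point compactification of a countable discrete space
(`exists_system_of_orbit_count`), so the existence of `(Y, S)` is the arithmetic question whether
natural numbers `o d` exist with `∑_{d ∣ n} d o(d)` equal to the prescribed count.

For odd `d` one has to take `o d = 2 ^ ((d - 1) / 2)`. Let `h d` be the numbers with
`∑_{d ∣ n} d h(d) = 2 ^ n`; they count the orbits of the Frobenius map of an algebraic closure of
`𝔽₂`. The count `2 ^ n + 1` at even `n` is then equivalent to `o d = h d` for `4 ∣ d` and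
`2 o(2m) = 2 h(2m) + h(m) + [m = 1] - 2 ^ ((m - 1) / 2)` for odd `m`. The right-hand side of the
latter is even because `h m` is even, and it is nonnegative because `h (2m)` is large
(`exists_halving_orbit_count`).

In the doubled system odd periods disappear and even ones have `2 (2 ^ n + 1)` points, so the
logarithmic derivative of its zeta function is that of `1 / ((1 - z²) (1 - 4 z²))`
(`zeta_eq_inv`).

If `ζ_S = P / Q`, then its logarithmic derivative is a rational function with the integer
coefficients `F_S(n)`, which therefore satisfy a linear recurrence over `ℂ`. An additive map from
the `ℤ`-span of the coefficients of the recurrence to `ℤ / 3`, nonzero on at least one of them,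
turns it into a recurrence modulo `3`, so `F_S` is eventually periodic modulo `3`, with some period
`N` (`eventually_periodic_of_isRational_zeta`). But `d 2 ^ ((d - 1) / 2)` is `1` modulo `3` for
`d ≡ 1` modulo `12`, so a large prime `p ≡ 1` modulo `12 N` has `F_S(p) ≡ 2` and `F_S(p²) ≡ 0`,
although `p ≡ p²` modulo `N` (`not_isRational_zeta_of_numPeriodic_odd`).
-/

namespace Halving

/-! ### Orbit counts -/

open Function in
/-- The points of least period `n` split into orbits of size `n`. -/
theorem dvd_card_minimalPeriod_eq {X : Type*} (f : X → X) {n : ℕ} (hn : 0 < n) (s : Finset X)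
    (hs : ∀ x, x ∈ s ↔ minimalPeriod f x = n) : n ∣ s.card := by
  classical
  rw [Finset.card_eq_sum_card_image (periodicOrbit f) s]
  refine Finset.dvd_sum fun c hc => ?_
  obtain ⟨x, hx, rfl⟩ := Finset.mem_image.1 hc
  have hxn := (hs x).1 hx
  have hper : ∀ y ∈ s, y ∈ periodicPts f := fun y hy =>
    minimalPeriod_pos_iff_mem_periodicPts.1 (by rw [(hs y).1 hy]; exact hn)
  have hfib : {y ∈ s | periodicOrbit f y = periodicOrbit f x} =
      (Finset.range n).image fun k => f^[k] x := by
    ext y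
    simp only [Finset.mem_filter, Finset.mem_image, Finset.mem_range]
    constructor
    · rintro ⟨hy, h⟩
      have h1 := self_mem_periodicOrbit (hper y hy)
      rw [h, mem_periodicOrbit_iff (hper x hx)] at h1
      obtain ⟨k, hk⟩ := h1
      refine ⟨k % n, Nat.mod_lt _ hn, ?_⟩
      rw [← hk, ← hxn, iterate_mod_minimalPeriod_eq]
    · rintro ⟨k, -, rfl⟩
      exact ⟨(hs _).2 (by rw [minimalPeriod_apply_iterate (hper x hx), hxn]),
        periodicOrbit_apply_iterate_eq (hper x hx) k⟩
  rw [hfib, Finset.card_image_of_injOn, Finset.card_range]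
  intro a ha b hb hab
  simp only [Finset.coe_range, Set.mem_Iio] at ha hb
  exact (iterate_eq_iterate_iff_of_lt_minimalPeriod (hxn ▸ ha) (hxn ▸ hb)).1 hab

open Function in
/-- The number of points fixed by `f^n` is the sum over `d ∣ n` of `d` times the number of orbits
of length `d`. -/
theorem exists_orbit_count {X : Type*} (f : X → X)
    (hf : ∀ n, 1 ≤ n → (ptsOfPeriod f n).Finite) :
    ∃ h : ℕ → ℕ, ∀ n, 1 ≤ n → ∑ d ∈ n.divisors, d * h d = (ptsOfPeriod f n).ncard := by
  classical
  refine ⟨fun d => {x | minimalPeriod f x = d}.ncard / d, fun n hn => ?_⟩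
  have hmem : ∀ x, x ∈ (hf n hn).toFinset ↔ minimalPeriod f x ∣ n := fun x => by
    rw [Set.Finite.mem_toFinset, mem_ptsOfPeriod, isPeriodicPt_iff_minimalPeriod_dvd]
  rw [Set.ncard_eq_toFinset_card _ (hf n hn),
    Finset.card_eq_sum_card_fiberwise (f := minimalPeriod f) (t := n.divisors)
      (fun x hx => Nat.mem_divisors.2 ⟨(hmem x).1 hx, by omega⟩)]
  refine Finset.sum_congr rfl fun d hd => ?_
  have hdn := (Nat.mem_divisors.1 hd).1
  have hd0 : 0 < d := Nat.pos_of_dvd_of_pos hdn hn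
  have hs : ∀ x, x ∈ {x ∈ (hf n hn).toFinset | minimalPeriod f x = d} ↔ minimalPeriod f x = d := by
    intro x
    rw [Finset.mem_filter, hmem]
    exact ⟨fun h => h.2, fun h => ⟨h ▸ hdn, h⟩⟩
  have hset : {x | minimalPeriod f x = d} =
      (({x ∈ (hf n hn).toFinset | minimalPeriod f x = d} : Finset X) : Set X) := by
    ext x
    rw [Finset.mem_coe, hs, Set.mem_ofPred_eq]
  beta_reduce
  rw [hset, Set.ncard_coe_finset]
  exact Nat.mul_div_cancel' (dvd_card_minimalPeriod_eq f hd0 _ hs)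

/-- The Frobenius map of an algebraic closure of `𝔽₂` has `2 ^ n` points of period `n`; the number
`h d` counts its orbits of length `d`. -/
theorem exists_sum_divisors_eq_two_pow :
    ∃ h : ℕ → ℕ, ∀ n, 1 ≤ n → ∑ d ∈ n.divisors, d * h d = 2 ^ n := by
  classical
  let K := AlgebraicClosure (ZMod 2)
  have hset : ∀ n, 1 ≤ n → Function.ptsOfPeriod (frobenius K 2) n =
      ((Polynomial.X ^ (2 ^ n) - Polynomial.X : Polynomial (ZMod 2)).rootSet K) := by
    intro n hn
    ext x
    rw [Polynomial.mem_rootSet_of_ne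
      (FiniteField.X_pow_card_pow_sub_X_ne_zero (ZMod 2) (by omega) one_lt_two),
      Function.mem_ptsOfPeriod, Function.IsPeriodicPt, Function.IsFixedPt, iterate_frobenius]
    simp [sub_eq_zero]
  have hfin : ∀ n, 1 ≤ n → (Function.ptsOfPeriod (frobenius K 2) n).Finite := by
    intro n hn
    rw [hset n hn]
    exact Polynomial.rootSet_finite _ _
  obtain ⟨h, hh⟩ := exists_orbit_count (frobenius K 2) hfin
  refine ⟨h, fun n hn => ?_⟩
  rw [hh n hn, hset n hn, ← Nat.card_coe_set_eq, Nat.card_eq_fintype_card,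
    Polynomial.card_rootSet_eq_natDegree
      (galois_poly_separable 2 _ (dvd_pow_self 2 (by omega))) (IsAlgClosed.splits _),
    FiniteField.X_pow_card_pow_sub_X_natDegree_eq _ (by omega) one_lt_two]

/-- The values `h d` at odd `d` are even, by induction from `∑_{e ∣ d} e h(e) = 2 ^ d`. -/
theorem even_of_sum_divisors_eq_two_pow {h : ℕ → ℕ}
    (hh : ∀ n, 1 ≤ n → ∑ d ∈ n.divisors, d * h d = 2 ^ n) {d : ℕ} (hd : Odd d) : Even (h d) := by
  induction d using Nat.strong_induction_on with
  | _ d ih =>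
    have hd0 : d ≠ 0 := by rintro rfl; simp at hd
    have h1 := hh d (by omega)
    rw [← Nat.cons_self_properDivisors hd0, Finset.sum_cons] at h1
    have h2 : Even (∑ e ∈ d.properDivisors, e * h e) := Finset.even_sum _ fun e he =>
      (ih e (Nat.mem_properDivisors.1 he).2
        (hd.of_dvd_nat (Nat.mem_properDivisors.1 he).1)).mul_left _
    have h3 : Even (d * h d + ∑ e ∈ d.properDivisors, e * h e) := by
      rw [h1]; exact (Nat.even_pow.2 ⟨even_two, hd0⟩)
    have h4 : Even (d * h d) := (Nat.even_add.1 h3).2 h2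
    rcases Nat.even_mul.1 h4 with h5 | h5
    · exact absurd hd (Nat.not_odd_iff_even.2 h5)
    · exact h5

/-- Points of period `2m` and smaller least period have least period at most `m`, so there are at
most `2 ^ (m + 1)` of them among the `2 ^ (2m)`. -/
theorem two_pow_le_of_sum_divisors_eq_two_pow {h : ℕ → ℕ}
    (hh : ∀ n, 1 ≤ n → ∑ d ∈ n.divisors, d * h d = 2 ^ n) {m : ℕ} (hm : 3 ≤ m) :
    2 ^ ((m - 1) / 2) ≤ 2 * h (2 * m) := by
  have h1 := hh (2 * m) (by omega)
  rw [← Nat.cons_self_properDivisors (by omega), Finset.sum_cons] at h1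
  have h2 : ∑ e ∈ (2 * m).properDivisors, e * h e ≤ ∑ e ∈ Finset.range (m + 1), 2 ^ e := by
    refine (Finset.sum_le_sum fun e he => ?_).trans
      (Finset.sum_le_sum_of_subset (f := fun e => 2 ^ e) fun e he => ?_)
    · have he0 : e ≠ 0 := (Nat.pos_of_mem_properDivisors he).ne'
      rw [← hh e (by omega)]
      exact Finset.single_le_sum (f := fun d => d * h d) (fun _ _ => Nat.zero_le _)
        (Nat.mem_divisors_self e he0)
    · obtain ⟨⟨k, hk⟩, hlt⟩ := Nat.mem_properDivisors.1 he
      rw [Finset.mem_range]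
      have : 2 ≤ k := by
        by_contra hk2
        interval_cases k <;> omega
      nlinarith
  rw [Nat.geomSum_eq le_rfl] at h2
  have h3 : 2 ^ (2 * m) ≤ 2 * m * h (2 * m) + 2 ^ (m + 1) := by
    rw [← h1]
    exact Nat.add_le_add_left (h2.trans ((Nat.div_le_self _ _).trans (Nat.sub_le _ _))) _
  have h4 : m < 2 ^ m := Nat.lt_two_pow_self
  have h5 : 2 ^ ((m - 1) / 2) ≤ 2 ^ (m - 1) := Nat.pow_le_pow_right two_pos (Nat.div_le_self _ _)
  have h6 : 2 ^ m = 2 * 2 ^ (m - 1) := by rw [← pow_succ']; congr 1; omega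
  have h7 : 4 ≤ 2 ^ (m - 1) :=
    (Nat.pow_le_pow_right two_pos (by omega : 2 ≤ m - 1)).trans' (by norm_num)
  have h8 : 2 ^ (2 * m) = 2 ^ m * 2 ^ m := by rw [two_mul, pow_add]
  have h9 : 2 ^ (m + 1) = 2 * 2 ^ m := pow_succ' 2 m
  refine h5.trans ?_
  by_contra! hlt
  have h10 : m * (2 * h (2 * m)) ≤ 2 ^ m * 2 ^ (m - 1) := Nat.mul_le_mul h4.le hlt.le
  rw [h8, h9] at h3
  nlinarith

/-- The orbit counts of the system to be constructed. -/
theorem exists_halving_orbit_count :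
    ∃ o : ℕ → ℕ, o 1 = 1 ∧ ∀ n, 1 ≤ n → ∑ d ∈ n.divisors, d * o d =
      if Even n then 2 ^ n + 1 else ∑ d ∈ n.divisors, d * 2 ^ ((d - 1) / 2) := by
  obtain ⟨h, hh⟩ := exists_sum_divisors_eq_two_pow
  have h1 : h 1 = 2 := by simpa using hh 1 le_rfl
  have h2 : h 2 = 1 := by
    have := hh 2 (by norm_num)
    rw [Nat.prime_two.sum_divisors] at this
    omega
  -- the number `c m` of orbits of length `2 * m` for odd `m`
  have hc : ∀ m, Odd m → ∃ c, 2 * c + 2 ^ ((m - 1) / 2) =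
      2 * h (2 * m) + h m + if m = 1 then 1 else 0 := by
    intro m hm
    rcases eq_or_ne m 1 with rfl | hm1
    · exact ⟨2, by simp [h1, h2]⟩
    have hm3 : 3 ≤ m := by
      obtain ⟨k, rfl⟩ := hm
      omega
    obtain ⟨a, ha⟩ := even_of_sum_divisors_eq_two_pow hh hm
    have hle := two_pow_le_of_sum_divisors_eq_two_pow hh hm3
    obtain ⟨b, hb⟩ : Even (2 ^ ((m - 1) / 2)) := Nat.even_pow.2 ⟨even_two, by omega⟩
    exact ⟨h (2 * m) + a - b, by rw [if_neg hm1]; omega⟩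
  choose! c hc using hc
  let o : ℕ → ℕ := fun d =>
    if Odd d then 2 ^ ((d - 1) / 2) else if Odd (d / 2) then c (d / 2) else h d
  have o_odd : ∀ d, Odd d → o d = 2 ^ ((d - 1) / 2) := fun d hd => if_pos hd
  have o_two_mul : ∀ m, Odd m → o (2 * m) = c m := fun m hm => by
    simp only [o]
    rw [if_neg (by simp), Nat.mul_div_cancel_left _ two_pos, if_pos hm]
  refine ⟨o, by rw [o_odd 1 odd_one]; rfl, fun n hn => ?_⟩
  split_ifs with hev
  swap
  · refine Finset.sum_congr rfl fun d hd => ?_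
    rw [o_odd d ((Nat.not_even_iff_odd.1 hev).of_dvd_nat (Nat.mem_divisors.1 hd).1)]
  -- the defect `g` of the counts vanishes at multiples of `4`, and `g (2 * m) = - g m` for odd `m`
  let g : ℕ → ℤ := fun d => d * (h d - o d) + if d = 1 then 1 else 0
  let σ : ℕ → ℕ := fun d => if Odd d then 2 * d else if Odd (d / 2) then d / 2 else d
  have σ_odd : ∀ d, Odd d → σ d = 2 * d := fun d hd => if_pos hd
  have σ_two_mul : ∀ m, Odd m → σ (2 * m) = m := fun m hm => by
    simp only [σ]
    rw [if_neg (by simp), Nat.mul_div_cancel_left _ two_pos, if_pos hm]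
  have g_two_mul : ∀ m, Odd m → g m + g (2 * m) = 0 := fun m hm => by
    have hcm : (2 * c m + 2 ^ ((m - 1) / 2) : ℤ) =
      2 * h (2 * m) + h m + if m = 1 then 1 else 0 := by exact_mod_cast hc m hm
    simp only [g]
    rw [o_odd m hm, o_two_mul m hm, if_neg (by omega : ¬ 2 * m = 1)]
    push_cast
    rcases eq_or_ne m 1 with rfl | hm1
    · norm_num at hcm ⊢
      linarith
    · simp only [if_neg hm1] at hcm ⊢
      linear_combination (-(m : ℤ)) * hcm
  have g_four : ∀ d, ¬ Odd d → ¬ Odd (d / 2) → g d = 0 := fun d hd hd2 => by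
    simp only [g, o]
    rw [if_neg hd, if_neg hd2, if_neg (by rintro rfl; exact hd odd_one)]
    ring
  have cases : ∀ d, Odd d ∨ (∃ m, Odd m ∧ d = 2 * m) ∨ (¬ Odd d ∧ ¬ Odd (d / 2)) := fun d => by
    by_cases hd : Odd d
    · exact Or.inl hd
    by_cases hd2 : Odd (d / 2)
    · obtain ⟨k, hk⟩ := Nat.not_odd_iff_even.1 hd
      exact Or.inr (Or.inl ⟨d / 2, hd2, by omega⟩)
    · exact Or.inr (Or.inr ⟨hd, hd2⟩)
  have σ_four : ∀ d, ¬ Odd d → ¬ Odd (d / 2) → σ d = d := fun d hd hd2 => by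
    simp only [σ]
    rw [if_neg hd, if_neg hd2]
  have key : ∑ d ∈ n.divisors, g d = 0 := by
    refine Finset.sum_involution (fun d _ => σ d) ?_ ?_ ?_ ?_
    · intro d _
      rcases cases d with hd | ⟨m, hm, rfl⟩ | ⟨hd, hd2⟩
      · rw [σ_odd d hd, g_two_mul d hd]
      · rw [σ_two_mul m hm, add_comm, g_two_mul m hm]
      · rw [σ_four d hd hd2, g_four d hd hd2, add_zero]
    · intro d hdn hg
      have hd0 := Nat.pos_of_mem_divisors hdn
      rcases cases d with hd | ⟨m, hm, rfl⟩ | ⟨hd, hd2⟩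
      · rw [σ_odd d hd]; omega
      · rw [σ_two_mul m hm]; omega
      · exact absurd (g_four d hd hd2) hg
    · intro d hdn
      obtain ⟨hdn, hn0⟩ := Nat.mem_divisors.1 hdn
      refine Nat.mem_divisors.2 ⟨?_, hn0⟩
      rcases cases d with hd | ⟨m, hm, rfl⟩ | ⟨hd, hd2⟩
      · rw [σ_odd d hd]
        exact (Nat.coprime_two_left.2 hd).mul_dvd_of_dvd_of_dvd hev.two_dvd hdn
      · rw [σ_two_mul m hm]
        exact (Dvd.intro_left 2 rfl).trans hdn
      · rwa [σ_four d hd hd2]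
    · intro d _
      rcases cases d with hd | ⟨m, hm, rfl⟩ | ⟨hd, hd2⟩
      · rw [σ_odd d hd, σ_two_mul d hd]
      · rw [σ_two_mul m hm, σ_odd m hm]
      · rw [σ_four d hd hd2, σ_four d hd hd2]
  have hsum : ((∑ d ∈ n.divisors, d * h d : ℕ) : ℤ) + 1 = (∑ d ∈ n.divisors, d * o d : ℕ) := by
    have h3 : ∑ d ∈ n.divisors, (if d = 1 then 1 else 0 : ℤ) = 1 := by
      rw [Finset.sum_ite_eq', if_pos (Nat.one_mem_divisors.2 (by omega))]
    simp only [g, Finset.sum_add_distrib, h3, mul_sub, Finset.sum_sub_distrib] at key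
    push_cast
    linarith
  rw [hh n hn] at hsum
  exact_mod_cast hsum.symm

/-! ### Zeta functions and their logarithmic derivatives -/

/-- `ζ_T` satisfies the differential equation `ζ' = ζ (log ζ)'`. -/
theorem derivative_zeta {X : Type*} (T : X → X) :
    PowerSeries.derivative ℂ (zeta T) = zeta T * PowerSeries.derivative ℂ (logZeta T) := by
  rw [zeta, PowerSeries.derivative_subst (hasSubst_logZeta T), PowerSeries.derivative_exp]

theorem constantCoeff_zeta {X : Type*} (T : X → X) :
    PowerSeries.constantCoeff (zeta T) = 1 := by
  refine (PowerSeries.constantCoeff_subst (hasSubst_logZeta T) _).trans ?_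
  rw [finsum_eq_single _ 0]
  · simp
  · intro n hn
    have : PowerSeries.constantCoeff (logZeta T ^ n) = 0 := by simp [logZeta, hn]
    exact (congrArg _ this).trans (smul_zero _)

theorem coeff_derivative_logZeta {X : Type*} (T : X → X) (n : ℕ) :
    PowerSeries.coeff n (PowerSeries.derivative ℂ (logZeta T)) = numPeriodic T (n + 1) := by
  have : (n + 1 : ℂ) ≠ 0 := Nat.cast_add_one_ne_zero n
  rw [PowerSeries.coeff_derivative, logZeta, PowerSeries.coeff_mk, if_neg (Nat.succ_ne_zero n)]
  push_cast
  field_simp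

theorem zeta_congr {X X' : Type*} {T : X → X} {T' : X' → X'}
    (h : ∀ n, 1 ≤ n → numPeriodic T n = numPeriodic T' n) : zeta T = zeta T' := by
  have : logZeta T = logZeta T' := by
    ext n
    simp only [logZeta, PowerSeries.coeff_mk]
    split_ifs with hn
    · rfl
    · rw [h n (Nat.one_le_iff_ne_zero.2 hn)]
  rw [zeta, zeta, this]

/-- Conjugate maps have equally many periodic points. -/
theorem numPeriodic_congr {X X' : Type*} {T : X → X} {T' : X' → X'} (e : X ≃ X')
    (h : ∀ x, e (T x) = T' (e x)) (n : ℕ) : numPeriodic T n = numPeriodic T' n := by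
  have hs : Function.Semiconj e T T' := h
  rw [numPeriodic, numPeriodic, ← Set.ncard_image_of_injective _ e.injective]
  congr 1
  ext y
  obtain ⟨x, rfl⟩ := e.surjective y
  rw [e.injective.mem_set_image, Function.mem_ptsOfPeriod, Function.mem_ptsOfPeriod,
    Function.IsPeriodicPt, Function.IsPeriodicPt, Function.IsFixedPt, Function.IsFixedPt,
    ← (hs.iterate_right n) x, e.apply_eq_iff_eq]

/-! ### The doubled system and its quotient -/

theorem iterate_doubled_map {Y : Type*} [MetricSpace Y] (S : Y ≃ₜ Y) (n : ℕ) (x : Doubled Y) :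
    (Doubled.map S)^[n] x = ⟨S^[n] x.point, x.parity + n⟩ := by
  induction n with
  | zero => simp
  | succ n ih =>
    rw [Function.iterate_succ_apply', Function.iterate_succ_apply', ih]
    simp [Doubled.map, add_assoc]

theorem mem_ptsOfPeriod_doubled_map {Y : Type*} [MetricSpace Y] (S : Y ≃ₜ Y) (n : ℕ)
    (x : Doubled Y) : x ∈ Function.ptsOfPeriod (Doubled.map S) n ↔
      Even n ∧ x.point ∈ Function.ptsOfPeriod S n := by
  rw [Function.mem_ptsOfPeriod, Function.mem_ptsOfPeriod, Function.IsPeriodicPt,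
    Function.IsPeriodicPt, Function.IsFixedPt, Function.IsFixedPt, iterate_doubled_map,
    Doubled.ext_iff, ← ZMod.natCast_eq_zero_iff_even]
  simp [and_comm]

/-- The two copies of `Y` exchange under `T`, so only even periods occur, each with two points of
the doubled space over every point of `Y`. -/
theorem ptsOfPeriod_doubled_map_of_even {Y : Type*} [MetricSpace Y] (S : Y ≃ₜ Y) {n : ℕ}
    (hn : Even n) : Function.ptsOfPeriod (Doubled.map S) n =
      (fun p : Y × ZMod 2 => (⟨p.1, p.2⟩ : Doubled Y)) '' (Function.ptsOfPeriod S n ×ˢ Set.univ) := by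
  ext x
  rw [mem_ptsOfPeriod_doubled_map]
  constructor
  · rintro ⟨-, h⟩
    exact ⟨(x.point, x.parity), ⟨h, trivial⟩, rfl⟩
  · rintro ⟨p, ⟨h, -⟩, rfl⟩
    exact ⟨hn, h⟩

theorem ptsOfPeriod_doubled_map_of_not_even {Y : Type*} [MetricSpace Y] (S : Y ≃ₜ Y) {n : ℕ}
    (hn : ¬ Even n) : Function.ptsOfPeriod (Doubled.map S) n = ∅ := by
  ext x
  rw [mem_ptsOfPeriod_doubled_map]
  exact iff_of_false (fun h => hn h.1) (Set.notMem_empty x)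

theorem numPeriodic_doubled_map {Y : Type*} [MetricSpace Y] (S : Y ≃ₜ Y) (n : ℕ) :
    numPeriodic (Doubled.map S) n = if Even n then 2 * numPeriodic S n else 0 := by
  split_ifs with hn
  · rw [numPeriodic, ptsOfPeriod_doubled_map_of_even S hn, Set.ncard_image_of_injective,
      Set.ncard_prod, numPeriodic, Set.ncard_univ, Nat.card_zmod, mul_comm]
    rintro ⟨a, b⟩ ⟨c, d⟩ h
    rw [Doubled.ext_iff] at h
    exact Prod.ext h.1 h.2
  · rw [numPeriodic, ptsOfPeriod_doubled_map_of_not_even S hn, Set.ncard_empty]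

/-- Collapsing the two copies of `Y` inverts the doubling. -/
def halvedDoubledHomeo (Y : Type*) [MetricSpace Y] :
    Halved (Doubled.flip (Y := Y)) Doubled.flip_involutive ≃ₜ Y where
  toFun := Quotient.lift Doubled.point (by rintro x y (rfl | rfl) <;> rfl)
  invFun y := Quotient.mk _ ⟨y, 0⟩
  left_inv q := by
    induction q using Quotient.inductionOn with
    | h x =>
      refine Quotient.sound ?_
      have h01 : ∀ e : ZMod 2, e = 0 ∨ e = 1 := by decide
      obtain ⟨y, e⟩ := x
      rcases h01 e with rfl | rfl
      · exact Or.inl rfl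
      · exact Or.inr rfl
  right_inv y := rfl
  continuous_toFun := by
    refine Continuous.quotient_lift (LipschitzWith.continuous (K := 1) ?_) _
    refine LipschitzWith.of_dist_le_mul fun x y => ?_
    rw [NNReal.coe_one, one_mul, Doubled.dist_def]
    split_ifs <;> linarith
  continuous_invFun := continuous_quotient_mk'.comp (Doubled.isometry_mk 0).continuous

/-! ### The zeta function of the doubled system -/

/-- If `F_T(n)` is `2 (2 ^ n + 1)` for even `n` and `0` for odd `n`, then `log ζ_T` is the sum
`∑_{m ≥ 1} (4 ^ m + 1) z ^ (2 m) / m = - log ((1 - z²) (1 - 4 z²))`. The two sides are compared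
through their logarithmic derivatives. -/
theorem zeta_eq_inv {X : Type*} (T : X → X)
    (h : ∀ n, 1 ≤ n → numPeriodic T n = if Even n then 2 * (2 ^ n + 1) else 0) :
    zeta T = ((1 - PowerSeries.X ^ 2) * (1 - 4 * PowerSeries.X ^ 2) : PowerSeries ℂ)⁻¹ := by
  set D : PowerSeries ℂ := (1 - PowerSeries.X ^ 2) * (1 - 4 * PowerSeries.X ^ 2) with hD
  have geom : ∀ a : ℂ, (1 - PowerSeries.C (a ^ 2) * PowerSeries.X ^ 2) *
      PowerSeries.mk (fun n => if Even n then 0 else 2 * a ^ (n + 1)) =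
      PowerSeries.C (2 * a ^ 2) * PowerSeries.X := by
    intro a
    ext n
    rw [sub_mul, one_mul, map_sub, mul_assoc, PowerSeries.coeff_C_mul, PowerSeries.coeff_mk,
      PowerSeries.coeff_C_mul, PowerSeries.coeff_X, PowerSeries.coeff_X_pow_mul']
    rcases n with _ | _ | n
    · simp
    · simp
    · simp only [PowerSeries.coeff_mk, Nat.even_add_one, not_not, show n + 1 + 1 - 2 = n by omega]
      split_ifs <;> first | omega | ring
  have hL : PowerSeries.derivative ℂ (logZeta T) =
      PowerSeries.mk (fun n => if Even n then 0 else 2 * (1 : ℂ) ^ (n + 1)) +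
      PowerSeries.mk (fun n => if Even n then 0 else 2 * (2 : ℂ) ^ (n + 1)) := by
    ext n
    rw [coeff_derivative_logZeta, h _ (by omega), map_add, PowerSeries.coeff_mk,
      PowerSeries.coeff_mk]
    by_cases hn : Even n
    · simp [Nat.even_add_one, hn]
    · simp only [Nat.even_add_one, hn, not_false_eq_true, if_true, if_false]
      push_cast
      ring
  have h1 := geom 1
  have h2 := geom 2
  have c4 : (PowerSeries.C (2 ^ 2 : ℂ)) = 4 := by
    rw [show (2 ^ 2 : ℂ) = 4 by norm_num]; exact map_ofNat _ 4
  have c8 : (PowerSeries.C (2 * 2 ^ 2 : ℂ)) = 8 := by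
    rw [show (2 * 2 ^ 2 : ℂ) = 8 by norm_num]; exact map_ofNat _ 8
  have c2 : (PowerSeries.C (2 * 1 ^ 2 : ℂ)) = 2 := by
    rw [show (2 * 1 ^ 2 : ℂ) = 2 by norm_num]; exact map_ofNat _ 2
  rw [c2, one_pow, map_one, one_mul] at h1
  rw [c4, c8] at h2
  have hDeriv : PowerSeries.derivative ℂ D =
      -(2 * PowerSeries.X) * (1 - 4 * PowerSeries.X ^ 2) -
        (1 - PowerSeries.X ^ 2) * (8 * PowerSeries.X) := by
    have e4 : (4 : PowerSeries ℂ) = PowerSeries.C 4 := (map_ofNat _ 4).symm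
    rw [hD, Derivation.leibniz, map_sub, map_sub, e4, Derivation.leibniz, PowerSeries.derivative_C,
      PowerSeries.derivative_pow, PowerSeries.derivative_X, Derivation.map_one_eq_zero, ← e4]
    simp only [smul_eq_mul]
    push_cast
    ring
  have hlog : D * PowerSeries.derivative ℂ (logZeta T) = -PowerSeries.derivative ℂ D := by
    rw [hL, hDeriv, hD]
    linear_combination (1 - 4 * PowerSeries.X ^ 2) * h1 + (1 - PowerSeries.X ^ 2) * h2
  have hmul : zeta T * D = 1 := by
    refine PowerSeries.derivative.ext ?_ ?_
    · rw [Derivation.leibniz, derivative_zeta, Derivation.map_one_eq_zero, smul_eq_mul, smul_eq_mul]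
      linear_combination zeta T * hlog
    · rw [map_mul, constantCoeff_zeta]
      simp [hD]
  rw [PowerSeries.eq_inv_iff_mul_eq_one (by simp [hD]), hmul]

/-! ### Irrationality -/

/-- A nonzero family of complex numbers has a nonzero image under some additive map from its
`ℤ`-span to `ZMod p`: the span is free, and a coordinate in a basis is onto `ℤ`. -/
theorem exists_addMonoidHom_zmod_ne_zero (p : ℕ) (hp : 1 < p) {k : ℕ} (q : Fin k → ℂ)
    (hq : q ≠ 0) : ∃ ψ : Submodule.span ℤ (Set.range q) →+ ZMod p,
      ∃ j, ψ ⟨q j, Submodule.subset_span ⟨j, rfl⟩⟩ ≠ 0 := by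
  set M := Submodule.span ℤ (Set.range q) with hM
  have hfin : Module.Finite ℤ M :=
    Module.Finite.iff_fg.2 (Submodule.fg_span (Set.finite_range q))
  have : Fact (1 < p) := ⟨hp⟩
  let b := Module.Free.chooseBasis ℤ M
  have hne : Nonempty (Module.Free.ChooseBasisIndex ℤ M) := by
    by_contra hempty
    rw [not_nonempty_iff] at hempty
    refine hq (funext fun j => ?_)
    have := b.ext_elem (x := ⟨q j, Submodule.subset_span ⟨j, rfl⟩⟩) (y := 0) fun i => hempty.elim i
    exact congrArg Subtype.val this
  obtain ⟨i⟩ := hne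
  let ψ : M →+ ZMod p := (Int.castAddHom (ZMod p)).comp (b.coord i).toAddMonoidHom
  refine ⟨ψ, ?_⟩
  by_contra! hall
  have hzero : ∀ (x : ℂ) (hx : x ∈ M), ψ ⟨x, hx⟩ = 0 := by
    intro x hx
    induction hx using Submodule.span_induction with
    | mem x hx =>
      obtain ⟨j, rfl⟩ := hx
      exact hall j
    | zero => exact map_zero ψ
    | add x y hx hy h1 h2 =>
      exact (map_add ψ ⟨x, hx⟩ ⟨y, hy⟩).trans (by rw [h1, h2, add_zero])
    | smul a x hx h1 =>
      exact (map_zsmul ψ a ⟨x, hx⟩).trans (by rw [h1, smul_zero])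
  have h1 := hzero (b i) (b i).2
  simp [ψ] at h1

/-- A sequence in a finite field satisfying a linear recurrence with a nonzero coefficient is eventually periodic: the window of `J` consecutive terms, where `J` is the last index with
nonzero coefficient, takes some value twice and determines the following term. -/
theorem eventually_periodic_of_recurrence {K : Type*} [Field K] [Finite K] (a : ℕ → K) {k n₀ : ℕ}
    (c : ℕ → K) (hc : ∃ j < k, c j ≠ 0)
    (hrec : ∀ n, n₀ ≤ n → ∑ j ∈ Finset.range k, c j * a (n + j) = 0) :
    ∃ m N, 0 < N ∧ ∀ n, m ≤ n → a (n + N) = a n := by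
  classical
  let J := Nat.findGreatest (fun j => j < k ∧ c j ≠ 0) k
  obtain ⟨j, hjk, hj⟩ := hc
  have hJ : J < k ∧ c J ≠ 0 :=
    Nat.findGreatest_spec (P := fun j => j < k ∧ c j ≠ 0) hjk.le ⟨hjk, hj⟩
  have hzero : ∀ i < k, J < i → c i = 0 := fun i hi hJi => by
    by_contra h
    exact Nat.findGreatest_is_greatest hJi hi.le ⟨hi, h⟩
  have hrec' : ∀ n, n₀ ≤ n → ∑ j ∈ Finset.range J, c j * a (n + j) + c J * a (n + J) = 0 := by
    intro n hn
    rw [← Finset.sum_range_succ, ← hrec n hn]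
    refine Finset.sum_subset (fun i hi => ?_) fun i hi hi' => ?_
    · rw [Finset.mem_range] at hi ⊢
      omega
    · rw [Finset.mem_range] at hi hi'
      rw [hzero i hi (by omega), zero_mul]
  have hnext : ∀ n n', n₀ ≤ n → n₀ ≤ n' → (∀ i < J, a (n + i) = a (n' + i)) →
      a (n + J) = a (n' + J) := by
    intro n n' hn hn' h
    have h1 := hrec' n hn
    rw [Finset.sum_congr rfl fun i hi => by rw [h i (Finset.mem_range.1 hi)], ← hrec' n' hn'] at h1
    exact mul_left_cancel₀ hJ.2 (add_left_cancel h1)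
  obtain ⟨x, y, hxy, hw⟩ := Finite.exists_ne_map_eq_of_infinite
    fun (n : ℕ) (i : Fin J) => a (n₀ + n + i)
  wlog hlt : x < y generalizing x y
  · exact this y x hxy.symm hw.symm (by omega)
  obtain ⟨N, rfl⟩ := Nat.exists_eq_add_of_lt hlt
  have hshift : ∀ t, ∀ i < J, a (n₀ + x + t + i) = a (n₀ + (x + N + 1) + t + i) := by
    intro t
    induction t with
    | zero => exact fun i hi => congrFun hw ⟨i, hi⟩
    | succ t ih =>
      intro i hi
      rcases Nat.lt_or_ge (i + 1) J with h | h
      · convert ih (i + 1) h using 2 <;> omega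
      · convert hnext _ _ (by omega) (by omega) ih using 2 <;> omega
  refine ⟨n₀ + x + J, N + 1, Nat.succ_pos N, fun n hn => ?_⟩
  obtain ⟨t, rfl⟩ := Nat.exists_eq_add_of_le hn
  convert (hnext _ _ (by omega) (by omega) (hshift t)).symm using 2 <;> omega

/-- If `ζ_T` is a rational function, then so is `z ζ_T' / ζ_T = ∑ F_T(n) z ^ n`. Its integer
coefficients satisfy a linear recurrence over `ℂ`, and thereby a nonzero one modulo each prime. -/
theorem eventually_periodic_of_isRational_zeta {X : Type*} (T : X → X) (hT : IsRational (zeta T))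
    (p : ℕ) [Fact p.Prime] :
    ∃ m N, 0 < N ∧ ∀ n, m ≤ n → (numPeriodic T (n + N) : ZMod p) = numPeriodic T n := by
  obtain ⟨P, Q, hQ, hPQ⟩ := hT
  have hζ : zeta T ≠ 0 := fun h => by simpa [h] using constantCoeff_zeta T
  have hP : P ≠ 0 := by
    rintro rfl
    rw [Polynomial.coe_zero, mul_eq_zero, Polynomial.coe_eq_zero_iff] at hPQ
    exact hPQ.elim hQ hζ
  set R := Q * P with hR
  have hR0 : R ≠ 0 := mul_ne_zero hQ hP
  set A := Polynomial.derivative P * Q - Polynomial.derivative Q * P with hA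
  have hRA : (R : PowerSeries ℂ) * PowerSeries.derivative ℂ (logZeta T) = A := by
    have h1 := congrArg (PowerSeries.derivative ℂ) hPQ
    rw [Derivation.leibniz, derivative_zeta, PowerSeries.derivative_coe,
      PowerSeries.derivative_coe, smul_eq_mul, smul_eq_mul] at h1
    rw [hR, hA]
    push_cast
    rw [← h1, ← hPQ]
    ring
  set k := R.natDegree + 1 with hk
  -- reversing the coefficients of `R` turns the convolution into a forward recurrence
  let q : Fin k → ℂ := fun j => R.coeff (R.natDegree - j)
  have hq : q ≠ 0 := fun h => by
    have := congrFun h ⟨0, Nat.succ_pos _⟩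
    simp only [q, Nat.sub_zero, Pi.zero_apply] at this
    exact hR0 (Polynomial.leadingCoeff_eq_zero.1 this)
  have hrec : ∀ n, A.natDegree < n →
      ∑ j : Fin k, q j * (numPeriodic T (n + 1 + j) : ℂ) = 0 := by
    intro n hn
    have h1 := congrArg (PowerSeries.coeff (n + R.natDegree)) hRA
    rw [Polynomial.coeff_coe, Polynomial.coeff_eq_zero_of_natDegree_lt (by omega),
      PowerSeries.coeff_mul, Finset.Nat.sum_antidiagonal_eq_sum_range_succ_mk] at h1
    rw [← h1, Fin.sum_univ_eq_sum_range
      (fun j => R.coeff (R.natDegree - j) * (numPeriodic T (n + 1 + j) : ℂ)) k,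
      ← Finset.sum_range_reflect]
    refine (Finset.sum_congr rfl fun j hj => ?_).trans
      (Finset.sum_subset (Finset.range_mono (by omega : k ≤ n + R.natDegree + 1)) ?_)
    · rw [Finset.mem_range] at hj
      simp only [Polynomial.coeff_coe, coeff_derivative_logZeta]
      congr 2
      · omega
      · congr 1; omega
    · intro j _ hj
      rw [Finset.mem_range] at hj
      simp only [Polynomial.coeff_coe]
      rw [Polynomial.coeff_eq_zero_of_natDegree_lt (by omega), zero_mul]
  obtain ⟨ψ, j₀, hj₀⟩ := exists_addMonoidHom_zmod_ne_zero p (Fact.out : p.Prime).one_lt q hq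
  let c : ℕ → ZMod p := fun j =>
    if hj : j < k then ψ ⟨q ⟨j, hj⟩, Submodule.subset_span ⟨_, rfl⟩⟩ else 0
  have hc : ∀ j : Fin k, c j = ψ ⟨q j, Submodule.subset_span ⟨_, rfl⟩⟩ := fun j => dif_pos j.2
  obtain ⟨m, N, hN, h⟩ := eventually_periodic_of_recurrence
    (fun n => (numPeriodic T (n + 1) : ZMod p)) (n₀ := A.natDegree + 1) c
    ⟨j₀, j₀.2, by rw [hc]; exact hj₀⟩ fun n hn => by
      rw [← Fin.sum_univ_eq_sum_range (fun j => c j * (numPeriodic T (n + j + 1) : ZMod p)) k]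
      have h1 : ∑ j : Fin k, numPeriodic T (n + 1 + j) •
          (⟨q j, Submodule.subset_span ⟨_, rfl⟩⟩ : Submodule.span ℤ (Set.range q)) = 0 := by
        refine Subtype.ext ?_
        rw [Submodule.coe_zero, ← hrec n hn, AddSubmonoidClass.coe_finsetSum]
        refine Finset.sum_congr rfl fun j _ => ?_
        exact (nsmul_eq_mul _ _).trans (mul_comm _ _)
      have h2 := congrArg ψ h1
      rw [map_zero, map_sum] at h2
      rw [← h2]
      refine Finset.sum_congr rfl fun j _ => ?_
      rw [map_nsmul, hc, nsmul_eq_mul, mul_comm, add_right_comm]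
  refine ⟨m + 1, N, hN, fun n hn => ?_⟩
  obtain ⟨t, rfl⟩ := Nat.exists_eq_add_of_le hn
  convert h (m + t) (by omega) using 3 <;> omega

/-- For a prime `p ≡ 1` modulo `12 N`, the sums `∑_{d ∣ n} d 2 ^ ((d - 1) / 2)` at `n = p` and
`n = p ^ 2` are `2` and `0` modulo `3`, whereas `p ≡ p ^ 2` modulo `N`. -/
theorem not_isRational_zeta_of_numPeriodic_odd {X : Type*} (T : X → X)
    (h : ∀ n, Odd n → numPeriodic T n = ∑ d ∈ n.divisors, d * 2 ^ ((d - 1) / 2)) :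
    ¬ IsRational (zeta T) := by
  intro hrat
  obtain ⟨m, N, hN, hper⟩ := eventually_periodic_of_isRational_zeta T hrat 3
  obtain ⟨p, hp, hmp, hmod⟩ := Nat.exists_prime_gt_modEq_one (k := 12 * N) m (by omega)
  obtain ⟨r, hr⟩ := (Nat.modEq_iff_dvd' hp.one_lt.le).1 hmod.symm
  have hpr : p = 12 * (N * r) + 1 := by rw [← mul_assoc, ← hr]; have := hp.one_lt; omega
  have hper' : ∀ t, (numPeriodic T (p + t * N) : ZMod 3) = numPeriodic T p := by
    intro t
    induction t with
    | zero => simp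
    | succ t ih =>
      rw [← ih, ← hper (p + t * N) (by omega)]
      congr 2
      ring
  have hsq : p + 12 * r * p * N = p ^ 2 := by
    calc p + 12 * r * p * N = p * (12 * (N * r) + 1) := by ring
      _ = p ^ 2 := by rw [← hpr, sq]
  have term : ∀ s, ((12 * s + 1) * 2 ^ ((12 * s + 1 - 1) / 2) : ℕ) = (1 : ZMod 3) := by
    intro s
    rw [show (12 * s + 1 - 1) / 2 = 2 * (3 * s) by omega, pow_mul]
    push_cast
    rw [show (12 : ZMod 3) = 0 by decide, show (4 : ZMod 3) = 1 by decide]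
    simp
  have hodd : Odd p := ⟨6 * (N * r), by omega⟩
  have e1 : (numPeriodic T p : ZMod 3) = 2 := by
    rw [h p hodd, hp.sum_divisors]
    have := term (N * r)
    rw [← hpr] at this
    rw [Nat.cast_add, this]
    simp
    decide
  have e2 : (numPeriodic T (p ^ 2) : ZMod 3) = 0 := by
    rw [h _ hodd.pow, Nat.sum_divisors_prime_pow hp, Finset.sum_range_succ, Finset.sum_range_succ,
      Finset.sum_range_one]
    have t1 := term (N * r)
    have t2 := term (12 * (N * r) * (N * r) + 2 * (N * r))
    rw [← hpr] at t1
    rw [show 12 * (12 * (N * r) * (N * r) + 2 * (N * r)) + 1 = p ^ 2 by rw [hpr]; ring] at t2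
    rw [Nat.cast_add, Nat.cast_add, pow_one, t1, t2]
    simp
    decide
  have h3 := hper' (12 * r * p)
  rw [hsq, e1, e2] at h3
  exact absurd h3 (by decide)

/-! ### Realization of orbit counts -/

/-- A permutation of a countable set `P` extends to a homeomorphism of the one-point
compactification of the discrete space `P`, which is metrizable: an injection of `P` into `ℕ`
embeds it in `{0} ∪ {1 / (n + 1)}`. -/
theorem exists_homeomorph_option_map (P : Type) [Countable P] (f : Equiv.Perm P) :
    ∃ (Y : Type) (_ : MetricSpace Y) (_ : CompactSpace Y) (S : Y ≃ₜ Y) (e : Y ≃ Option P),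
      ∀ y, e (S y) = (e y).map f := by
  let _ : TopologicalSpace P := ⊥
  have : DiscreteTopology P := ⟨rfl⟩
  obtain ⟨ν, hν⟩ := exists_injective_nat P
  let w : OnePoint P → ℝ := fun x => x.elim 0 fun a => 1 / ((ν a : ℝ) + 1)
  have hw_inj : Function.Injective w := by
    have hpos : ∀ a, 0 < 1 / ((ν a : ℝ) + 1) := fun a => Nat.one_div_pos_of_nat
    intro x y h
    induction x using OnePoint.rec with
    | infty =>
      induction y using OnePoint.rec with
      | infty => rfl
      | coe b => exact absurd h (hpos b).ne
    | coe a =>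
      induction y using OnePoint.rec with
      | infty => exact absurd h (hpos a).ne'
      | coe b =>
        have h' : 1 / ((ν a : ℝ) + 1) = 1 / ((ν b : ℝ) + 1) := h
        rw [one_div, one_div, inv_inj, add_left_inj, Nat.cast_inj] at h'
        rw [hν h']
  have hw_cont : Continuous w := by
    rw [OnePoint.continuous_iff_from_discrete]
    have h1 : Filter.Tendsto ν Filter.cofinite Filter.atTop := by
      rw [← Nat.cofinite_eq_atTop]
      exact hν.tendsto_cofinite
    exact tendsto_one_div_add_atTop_nhds_zero_nat.comp h1
  have hw : Topology.IsEmbedding w := (hw_cont.isClosedEmbedding hw_inj).isEmbedding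
  refine ⟨OnePoint P, hw.comapMetricSpace w, inferInstance,
    (Equiv.toHomeomorphOfDiscrete f).onePointCongr, Equiv.refl _, fun y => ?_⟩
  induction y using OnePoint.rec with
  | infty => rfl
  | coe a => rfl

theorem iterate_option_map {P : Type*} (f : P → P) (n : ℕ) :
    (Option.map f)^[n] = Option.map f^[n] := by
  induction n with
  | zero => simp
  | succ n ih => rw [Function.iterate_succ, ih, Option.map_comp_map, Function.iterate_succ]

/-- The permutation with `o (k + 1)` cycles of length `k + 1` for each `k`. -/
def cyclesPerm (o : ℕ → ℕ) : Equiv.Perm (Σ k : ℕ, Fin (o (k + 1)) × ZMod (k + 1)) :=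
  Equiv.sigmaCongrRight fun _ => Equiv.prodCongr (Equiv.refl _) (Equiv.addRight 1)

theorem iterate_cyclesPerm (o : ℕ → ℕ) (n : ℕ) (x : Σ k : ℕ, Fin (o (k + 1)) × ZMod (k + 1)) :
    (cyclesPerm o)^[n] x = ⟨x.1, x.2.1, x.2.2 + n⟩ := by
  induction n with
  | zero => simp
  | succ n ih =>
    rw [Function.iterate_succ_apply', ih, Nat.cast_succ, ← add_assoc]
    rfl

theorem mem_ptsOfPeriod_cyclesPerm (o : ℕ → ℕ) (n : ℕ)
    (x : Σ k : ℕ, Fin (o (k + 1)) × ZMod (k + 1)) :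
    x ∈ Function.ptsOfPeriod (cyclesPerm o) n ↔ x.1 + 1 ∣ n := by
  obtain ⟨k, i, a⟩ := x
  rw [Function.mem_ptsOfPeriod, Function.IsPeriodicPt, Function.IsFixedPt, iterate_cyclesPerm,
    ← ZMod.natCast_eq_zero_iff]
  simp

/-- Besides the point at infinity, the points of period `n` of the extension of `cyclesPerm o` are
the points of the cycles whose length divides `n`. -/
theorem ptsOfPeriod_option_map_cyclesPerm (o : ℕ → ℕ) {n : ℕ} (hn : 1 ≤ n) :
    Function.ptsOfPeriod (Option.map (cyclesPerm o)) n =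
      ((({k ∈ Finset.range n | k + 1 ∣ n}.sigma fun _ => Finset.univ).insertNone :
        Finset (Option (Σ k : ℕ, Fin (o (k + 1)) × ZMod (k + 1)))) : Set _) := by
  ext x
  rw [Function.mem_ptsOfPeriod, Function.IsPeriodicPt, Function.IsFixedPt, iterate_option_map,
    Finset.mem_coe, Finset.mem_insertNone]
  rcases x with _ | x
  · simp
  · have h := mem_ptsOfPeriod_cyclesPerm o n x
    rw [Function.mem_ptsOfPeriod, Function.IsPeriodicPt, Function.IsFixedPt] at h
    rw [Option.map_some, Option.some_inj, h]
    simp only [Option.mem_some_iff, forall_eq', Finset.mem_sigma, Finset.mem_filter,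
      Finset.mem_range, Finset.mem_univ, and_true]
    exact ⟨fun h => ⟨Nat.le_of_dvd hn h, h⟩, fun h => h.2⟩

theorem numPeriodic_option_map_cyclesPerm (o : ℕ → ℕ) {n : ℕ} (hn : 1 ≤ n) :
    numPeriodic (Option.map (cyclesPerm o)) n = ∑ d ∈ n.divisors, d * o d + 1 := by
  rw [numPeriodic, ptsOfPeriod_option_map_cyclesPerm o hn, Set.ncard_coe_finset,
    Finset.card_insertNone, Finset.card_sigma, Finset.sum_filter, Nat.divisors, Finset.sum_filter,
    Finset.range_eq_Ico, ← Finset.sum_Ico_add' (fun d => if d ∣ n then d * o d else 0) 0 n 1]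
  simp [ZMod.card, mul_comm]

/-- A system with a fixed point and with prescribed numbers `o d` of orbits of length `d`: one of
the fixed points is the limit of all other orbits. -/
theorem exists_system_of_orbit_count (o : ℕ → ℕ) (ho : o 1 = 1) :
    ∃ (Y : Type) (_ : MetricSpace Y) (_ : CompactSpace Y) (S : Y ≃ₜ Y),
      IsTopologicalDynamicalSystem S ∧
      ∀ n, 1 ≤ n → numPeriodic S n = ∑ d ∈ n.divisors, d * o d := by
  -- the only fixed point is the point at infinity
  let o' : ℕ → ℕ := fun d => if d = 1 then 0 else o d
  obtain ⟨Y, hY, hc, S, e, he⟩ := exists_homeomorph_option_map _ (cyclesPerm o')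
  have hsemi : Function.Semiconj e S (Option.map (cyclesPerm o')) := he
  refine ⟨Y, hY, hc, S, ⟨⟨e.symm none, ?_⟩, fun n hn => ?_⟩, fun n hn => ?_⟩
  · rw [← e.apply_eq_iff_eq, he, e.apply_symm_apply, Option.map_none]
  · refine Set.Finite.of_finite_image (f := e) ?_ e.injective.injOn
    refine Set.Finite.subset ?_ (hsemi.mapsTo_ptsOfPeriod n).image_subset
    rw [ptsOfPeriod_option_map_cyclesPerm o' hn]
    exact Finset.finite_toSet _
  · rw [numPeriodic_congr e he, numPeriodic_option_map_cyclesPerm o' hn]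
    have h1 : 1 ∈ n.divisors := Nat.one_mem_divisors.2 (by omega)
    rw [← Finset.sum_erase_add _ _ h1, ← Finset.sum_erase_add _ (fun d => d * o d) h1, ho]
    simp only [o', if_true, mul_zero, add_zero, mul_one]
    congr 1
    exact Finset.sum_congr rfl fun d hd => by rw [if_neg (Finset.ne_of_mem_erase hd)]

end Halving

theorem mainTheorem7 :
    ∃ (Y : Type) (_ : MetricSpace Y) (_ : CompactSpace Y) (S : Y ≃ₜ Y),
      -- `(Y, S)` is a topological dynamical system with the prescribed periodic point counts
      Halving.IsTopologicalDynamicalSystem S ∧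
      (∀ n : ℕ, 1 ≤ n → Halving.numPeriodic S n =
        if Even n then 2 ^ n + 1 else ∑ d ∈ n.divisors, d * 2 ^ ((d - 1) / 2)) ∧
      -- the zeta function of the doubled map is the stated rational function
      (∀ n : ℕ, 1 ≤ n → (Function.ptsOfPeriod (Halving.Doubled.map S) n).Finite) ∧
      Halving.zeta (Halving.Doubled.map S) =
        ((1 - PowerSeries.X ^ 2) * (1 - 4 * PowerSeries.X ^ 2) : PowerSeries ℂ)⁻¹ ∧
      Halving.IsRational (Halving.zeta (Halving.Doubled.map S)) ∧
      -- the halved system of the doubled map is identified with `(Y, S)` by `[(y, e)] ↦ y`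
      (∃ h : Halving.Halved Halving.Doubled.flip Halving.Doubled.flip_involutive ≃ₜ Y,
        (∀ x : Halving.Doubled Y, h (Quotient.mk _ x) = x.point) ∧
        ∀ q, h (Halving.halvedMap (Halving.Doubled.map S) Halving.Doubled.flip
          Halving.Doubled.flip_involutive (Halving.Doubled.map_commute_flip S) q) = S (h q)) ∧
      -- the common zeta function of the halved system and of `S` is irrational
      Halving.zeta (Halving.halvedMap (Halving.Doubled.map S) Halving.Doubled.flip
          Halving.Doubled.flip_involutive (Halving.Doubled.map_commute_flip S)) =
        Halving.zeta S ∧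
      ¬ Halving.IsRational (Halving.zeta S) := by
  obtain ⟨o, ho, hsum⟩ := Halving.exists_halving_orbit_count
  obtain ⟨Y, hY, hc, S, hS, hnum⟩ := Halving.exists_system_of_orbit_count o ho
  have hF : ∀ n : ℕ, 1 ≤ n → Halving.numPeriodic S n =
      if Even n then 2 ^ n + 1 else ∑ d ∈ n.divisors, d * 2 ^ ((d - 1) / 2) :=
    fun n hn => (hnum n hn).trans (hsum n hn)
  have hζ : Halving.zeta (Halving.Doubled.map S) =
      ((1 - PowerSeries.X ^ 2) * (1 - 4 * PowerSeries.X ^ 2) : PowerSeries ℂ)⁻¹ := by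
    refine Halving.zeta_eq_inv _ fun n hn => ?_
    rw [Halving.numPeriodic_doubled_map, hF n hn]
    split_ifs <;> rfl
  have hconj : ∀ q, Halving.halvedDoubledHomeo Y (Halving.halvedMap (Halving.Doubled.map S)
      Halving.Doubled.flip Halving.Doubled.flip_involutive
      (Halving.Doubled.map_commute_flip S) q) = S (Halving.halvedDoubledHomeo Y q) := by
    intro q
    induction q using Quotient.inductionOn with
    | h x => rfl
  refine ⟨Y, hY, hc, S, hS, hF, fun n hn => ?_, hζ, ?_,
    ⟨Halving.halvedDoubledHomeo Y, fun _ => rfl, hconj⟩,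
    Halving.zeta_congr fun n _ =>
      Halving.numPeriodic_congr (Halving.halvedDoubledHomeo Y).toEquiv hconj n,
    Halving.not_isRational_zeta_of_numPeriodic_odd _ fun n hn => ?_⟩
  · by_cases hev : Even n
    · rw [Halving.ptsOfPeriod_doubled_map_of_even S hev]
      exact ((hS.finite_periodic n hn).prod Set.finite_univ).image _
    · rw [Halving.ptsOfPeriod_doubled_map_of_not_even S hev]
      exact Set.finite_empty
  · refine ⟨1, (1 - Polynomial.X ^ 2) * (1 - Polynomial.C 4 * Polynomial.X ^ 2), fun h => ?_, ?_⟩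
    · have := congrArg (Polynomial.eval 0) h
      simp at this
    · have e4 : (PowerSeries.C 4 : PowerSeries ℂ) = 4 := map_ofNat _ 4
      rw [hζ]
      push_cast
      rw [e4]
      exact PowerSeries.mul_inv_cancel _ (by simp)
  · rw [hF n hn.pos, if_neg (Nat.not_even_iff_odd.2 hn)]
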